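/- Let $F\colon\mathbb{R}^p\times\mathbb{R}^m\to\mathbb{R}^p$ be locally Lipschitz and path differentiable jointly in $(x,\theta)$, with conservative Jacobian $J_F$, and let $x_0\colon\mathbb{R}^m\to\mathbb{R}^p$ be locally Lipschitz and path differentiable, with conservative Jacobian $J_{x_0}$. Here a set-valued map $J$ is called a conservative Jacobian of a locally Lipschitz map $f\colon\mathbb{R}^n\to\mathbb{R}^q$ if $J(z)\subset\mathbb{R}^{q\times n}$ is nonempty for every $z$, $J$ is locally bounded with closed graph, and for every absolutely continuous curve $\gamma\colon[0,1]\to\mathbb{R}^n$, for almost every $t$, $\frac{d}{dt}f(\gamma(t))=V\dot\gamma(t)$ for all $V\in J(\gamma(t))$. Assume that there is $\rho\in[0,1)$ such that for all $(x,\theta)$ and all $[A,B]\in J_F(x,\theta)$, with $A\in\mathbb{R}^{p\times p}$ and $B\in\mathbb{R}^{p\times m}$, the (Euclidean) operator norm of $A$ is at most $\rho$. Put $x_0=x_0(\theta)$ and $x_{k+1}=F(x_k,\theta)$. Consider the following two procedures. Forward mode, with input $(k,\theta,\dot\theta)$: choose $J\in J_{x_0}(\theta)$ and set $\dot x_0=J\dot\theta$;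 for $i=1,\dots,k$ choose $[A_{i-1},B_{i-1}]\in J_F(x_{i-1},\theta)$ and set $\dot x_i=A_{i-1}\dot x_{i-1}+B_{i-1}\dot\theta$; return $\dot x_k$. Reverse mode, with input $(k,\theta,\bar w_k)$: set $\bar\theta_k=0$; for $i=k,\dots,1$ choose $[A_{i-1},B_{i-1}]\in J_F(x_{i-1},\theta)$, replace $\bar\theta_k$ by $\bar\theta_k+B_{i-1}^T\bar w_i$ and set $\bar w_{i-1}=A_{i-1}^T\bar w_i$; finally choose $J\in J_{x_0}(\theta)$, replace $\bar\theta_k$ by $\bar\theta_k+J^T\bar w_0$, and return $\bar\theta_k$. Then for every $\theta\in\mathbb{R}^m$ the map $F(\cdot,\theta)$ has a unique fixed point $\bar x(\theta)$, and for almost every $\theta\in\mathbb{R}^m$ the map $\bar x$ is differentiable at $\theta$ and the following hold. 1. For every $\dot\theta\in\mathbb{R}^m$ and every sequence $(\dot x_k)_{k\in\mathbb{N}}$ of outputs of the forward mode with inputs $(k,\theta,\dot\theta)$, whatever choices are made in each run, $\dot x_k\to\frac{\partial\bar x}{\partial\theta}(\theta)\,\dot\theta$ as $k\to\infty$. 2.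 For every sequence $(\bar w_k)_{k\in\mathbb{N}}$ in $\mathbb{R}^p$ with $\bar w_k\to\bar w$, and every sequence $(\bar\theta_k)_{k\in\mathbb{N}}$ of outputs of the reverse mode with inputs $(k,\theta,\bar w_k)$, whatever choices are made in each run, $\bar\theta_k^T\to\bar w^T\frac{\partial\bar x}{\partial\theta}(\theta)$ as $k\to\infty$. -/

import Mathlib

open Set Filter Topology MeasureTheory

namespace Piggyback

/-- `J` is a conservative Jacobian for the locally Lipschitz map `f` (which is then called path
differentiable): `J` is a set-valued map with closed graph, locally bounded and nowhere empty, and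
along every absolutely continuous curve `γ : [0, 1] → E`, for almost every `t`,
`d/dt f (γ t) = V (γ' t)` for every `V ∈ J (γ t)`. Jacobian matrices are regarded as continuous
linear maps. -/
structure IsConservativeJacobian {E G : Type*} [NormedAddCommGroup E] [NormedSpace ℝ E]
    [NormedAddCommGroup G] [NormedSpace ℝ G] (f : E → G) (J : E → Set (E →L[ℝ] G)) : Prop where
  locallyLipschitz : LocallyLipschitz f
  isClosed_graph : IsClosed {q : E × (E →L[ℝ] G) | q.2 ∈ J q.1}
  locallyBounded : ∀ x : E, ∃ U ∈ 𝓝 x, ∃ C : ℝ, ∀ y ∈ U, ∀ V ∈ J y, ‖V‖ ≤ C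
  nonempty : ∀ x : E, (J x).Nonempty
  chain_rule : ∀ γ : ℝ → E, AbsolutelyContinuousOnInterval γ 0 1 →
    ∀ᵐ t : ℝ, t ∈ Ioo (0 : ℝ) 1 →
      ∀ V ∈ J (γ t), HasDerivAt (fun s => f (γ s)) (V (deriv γ t)) t

section Blocks

variable {X Θ G : Type*} [NormedAddCommGroup X] [NormedSpace ℝ X]
  [NormedAddCommGroup Θ] [NormedSpace ℝ Θ] [NormedAddCommGroup G] [NormedSpace ℝ G]

/-- The block `A` of the concatenation `M = [A, B]`. -/
def blockA (M : X × Θ →L[ℝ] G) : X →L[ℝ] G := M.comp (ContinuousLinearMap.inl ℝ X Θ)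

/-- The block `B` of the concatenation `M = [A, B]`. -/
def blockB (M : X × Θ →L[ℝ] G) : Θ →L[ℝ] G := M.comp (ContinuousLinearMap.inr ℝ X Θ)

end Blocks

/-- The iterates `x_0 = x_0(θ)`, `x_{k+1} = F(x_k, θ)`. -/
def iterate {X Θ : Type*} (F : X × Θ → X) (x₀ : Θ → X) (θ : Θ) : ℕ → X
  | 0 => x₀ θ
  | k + 1 => F (iterate F x₀ θ k, θ)

section Algorithm

variable {p m : ℕ}

/-- `ForwardMode F JF x₀ Jx₀ θ θdot k v`: the vector `v` is a possible value of the variable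
`ẋ_k` of the forward mode of algorithmic differentiation (Jacobian-vector product), for some
choice of the matrices in the conservative Jacobians met during the run. -/
inductive ForwardMode
    (F : EuclideanSpace ℝ (Fin p) × EuclideanSpace ℝ (Fin m) → EuclideanSpace ℝ (Fin p))
    (JF : EuclideanSpace ℝ (Fin p) × EuclideanSpace ℝ (Fin m) →
      Set (EuclideanSpace ℝ (Fin p) × EuclideanSpace ℝ (Fin m) →L[ℝ] EuclideanSpace ℝ (Fin p)))
    (x₀ : EuclideanSpace ℝ (Fin m) → EuclideanSpace ℝ (Fin p))
    (Jx₀ : EuclideanSpace ℝ (Fin m) →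
      Set (EuclideanSpace ℝ (Fin m) →L[ℝ] EuclideanSpace ℝ (Fin p)))
    (θ θdot : EuclideanSpace ℝ (Fin m)) : ℕ → EuclideanSpace ℝ (Fin p) → Prop
  | init (J : EuclideanSpace ℝ (Fin m) →L[ℝ] EuclideanSpace ℝ (Fin p)) (hJ : J ∈ Jx₀ θ) :
      ForwardMode F JF x₀ Jx₀ θ θdot 0 (J θdot)
  | step (i : ℕ) (xdot : EuclideanSpace ℝ (Fin p))
      (h : ForwardMode F JF x₀ Jx₀ θ θdot i xdot)
      (M : EuclideanSpace ℝ (Fin p) × EuclideanSpace ℝ (Fin m) →L[ℝ] EuclideanSpace ℝ (Fin p))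
      (hM : M ∈ JF (iterate F x₀ θ i, θ)) :
      ForwardMode F JF x₀ Jx₀ θ θdot (i + 1) (blockA M xdot + blockB M θdot)

/-- `ReverseLoop F JF x₀ θ k wk i w a`: in the backward loop `i = k, …, 1` of the reverse mode
started with `w̄_k = wk` and with the accumulator `θ̄_k` equal to `0`, the values `w̄_i = w` and
`θ̄_k = a` are possible when the loop reaches the index `i`. The matrices `Aᵀ` and `Bᵀ` are the
adjoints for the Euclidean inner products. -/
inductive ReverseLoop
    (F : EuclideanSpace ℝ (Fin p) × EuclideanSpace ℝ (Fin m) → EuclideanSpace ℝ (Fin p))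
    (JF : EuclideanSpace ℝ (Fin p) × EuclideanSpace ℝ (Fin m) →
      Set (EuclideanSpace ℝ (Fin p) × EuclideanSpace ℝ (Fin m) →L[ℝ] EuclideanSpace ℝ (Fin p)))
    (x₀ : EuclideanSpace ℝ (Fin m) → EuclideanSpace ℝ (Fin p))
    (θ : EuclideanSpace ℝ (Fin m)) (k : ℕ) (wk : EuclideanSpace ℝ (Fin p)) :
    ℕ → EuclideanSpace ℝ (Fin p) → EuclideanSpace ℝ (Fin m) → Prop
  | start : ReverseLoop F JF x₀ θ k wk k wk 0
  | step (i : ℕ) (w : EuclideanSpace ℝ (Fin p)) (a : EuclideanSpace ℝ (Fin m))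
      (h : ReverseLoop F JF x₀ θ k wk (i + 1) w a)
      (M : EuclideanSpace ℝ (Fin p) × EuclideanSpace ℝ (Fin m) →L[ℝ] EuclideanSpace ℝ (Fin p))
      (hM : M ∈ JF (iterate F x₀ θ i, θ)) :
      ReverseLoop F JF x₀ θ k wk i
        (ContinuousLinearMap.adjoint (blockA M) w)
        (a + ContinuousLinearMap.adjoint (blockB M) w)

/-- `ReverseMode F JF x₀ Jx₀ θ k wk b`: the vector `b` is a possible output `θ̄_k` of the reverse
mode of algorithmic differentiation (vector-Jacobian product) with inputs `k` and `w̄_k = wk`. -/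
def ReverseMode
    (F : EuclideanSpace ℝ (Fin p) × EuclideanSpace ℝ (Fin m) → EuclideanSpace ℝ (Fin p))
    (JF : EuclideanSpace ℝ (Fin p) × EuclideanSpace ℝ (Fin m) →
      Set (EuclideanSpace ℝ (Fin p) × EuclideanSpace ℝ (Fin m) →L[ℝ] EuclideanSpace ℝ (Fin p)))
    (x₀ : EuclideanSpace ℝ (Fin m) → EuclideanSpace ℝ (Fin p))
    (Jx₀ : EuclideanSpace ℝ (Fin m) →
      Set (EuclideanSpace ℝ (Fin m) →L[ℝ] EuclideanSpace ℝ (Fin p)))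
    (θ : EuclideanSpace ℝ (Fin m)) (k : ℕ) (wk : EuclideanSpace ℝ (Fin p))
    (b : EuclideanSpace ℝ (Fin m)) : Prop :=
  ∃ (w₀ : EuclideanSpace ℝ (Fin p)) (a : EuclideanSpace ℝ (Fin m)),
    ReverseLoop F JF x₀ θ k wk 0 w₀ a ∧
      ∃ J ∈ Jx₀ θ, b = a + ContinuousLinearMap.adjoint J w₀

end Algorithm

end Piggyback

/-! The heart is that, for almost every `θ`, the derivative `D` of the fixed point map satisfies `A
D + B = D` for every `[A, B]` in `JF (xbar θ, θ)`. Indeed `xbar` is locally Lipschitz, so the chain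
rule along `t ↦ (xbar (θ + t • v), θ + t • v)`, where `F` returns the first component, gives the
identity in direction `v` at almost every point of each line. Fubini passes from lines to the whole
space, and a basis of directions recovers `D`. At such a `θ`, closed graph and local boundedness of
`JF` make the defects `A D + B - D` at the iterates uniformly at most some `e n → 0`. Since `‖A‖ ≤ ρ
< 1`, both modes are then off by at most `u k` times the norm of their input, where `u (k + 1) = ρ *
u k + e k` tends to `0`. -/

namespace Piggyback

/-! ### Semicontinuity of conservative Jacobians. -/

section SetValued

variable {E G : Type*} [NormedAddCommGroup E] [NormedSpace ℝ E] [FiniteDimensional ℝ E]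
  [NormedAddCommGroup G] [NormedSpace ℝ G] [FiniteDimensional ℝ G]

/-- Matrices chosen in a conservative Jacobian along a convergent sequence have a subsequence that
converges to an element of the Jacobian at the limit. -/
theorem IsConservativeJacobian.exists_subseq_tendsto {f : E → G} {J : E → Set (E →L[ℝ] G)}
    (hJ : IsConservativeJacobian f J) {z : ℕ → E} {z₀ : E} (hz : Tendsto z atTop (𝓝 z₀))
    {M : ℕ → E →L[ℝ] G} (hM : ∀ n, M n ∈ J (z n)) :
    ∃ M₀ ∈ J z₀, ∃ ψ : ℕ → ℕ, StrictMono ψ ∧ Tendsto (M ∘ ψ) atTop (𝓝 M₀) := by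
  obtain ⟨U, hU, C, hC⟩ := hJ.locallyBounded z₀
  have hfreq : ∃ᶠ n in atTop, M n ∈ Metric.closedBall (0 : E →L[ℝ] G) C := by
    refine Eventually.frequently ?_
    filter_upwards [hz hU] with n hn
    simpa using hC _ hn _ (hM n)
  have : ProperSpace (E →L[ℝ] G) := FiniteDimensional.proper_real _
  obtain ⟨M₀, -, ψ, hψ, hlim⟩ :=
    tendsto_subseq_of_frequently_bounded Metric.isBounded_closedBall hfreq
  refine ⟨M₀, ?_, ψ, hψ, hlim⟩
  exact hJ.isClosed_graph.mem_of_tendsto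
    ((hz.comp hψ.tendsto_atTop).prodMk_nhds hlim) (Eventually.of_forall fun n => hM (ψ n))

/-- Violating matrices along a convergent sequence subconverge to a violating matrix at the limit.
Used both for the null bounds `e n` and for the measurability that Fubini requires. -/
theorem IsConservativeJacobian.isClosed_exists_le {Y : Type*} [TopologicalSpace Y]
    [SequentialSpace (E × Y)] {f : E → G} {J : E → Set (E →L[ℝ] G)}
    (hJ : IsConservativeJacobian f J) {φ : (E →L[ℝ] G) × Y → ℝ} (hφ : Continuous φ) (ε : ℝ) :
    IsClosed {q : E × Y | ∃ M ∈ J q.1, ε ≤ φ (M, q.2)} := by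
  refine IsSeqClosed.isClosed fun q q₀ hq hlim => ?_
  choose M hM hle using hq
  have h1 : Tendsto (fun n => (q n).1) atTop (𝓝 q₀.1) := (continuous_fst.tendsto _).comp hlim
  have h2 : Tendsto (fun n => (q n).2) atTop (𝓝 q₀.2) := (continuous_snd.tendsto _).comp hlim
  obtain ⟨M₀, hM₀, ψ, hψ, hlim'⟩ := hJ.exists_subseq_tendsto h1 hM
  refine ⟨M₀, hM₀, ?_⟩
  have := (hφ.tendsto _).comp (hlim'.prodMk_nhds (h2.comp hψ.tendsto_atTop))
  exact ge_of_tendsto' this fun n => hle (ψ n)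

/-- A continuous function that vanishes on the Jacobian at the limit of a sequence is dominated on
the Jacobians along the sequence by a null sequence. -/
theorem IsConservativeJacobian.exists_tendsto_zero_bound {f : E → G} {J : E → Set (E →L[ℝ] G)}
    (hJ : IsConservativeJacobian f J) {z : ℕ → E} {z₀ : E} (hz : Tendsto z atTop (𝓝 z₀))
    {φ : (E →L[ℝ] G) → ℝ} (hφ : Continuous φ) (hφ0 : ∀ M, 0 ≤ φ M) (hφJ : ∀ M ∈ J z₀, φ M = 0) :
    ∃ e : ℕ → ℝ, Tendsto e atTop (𝓝 0) ∧ ∀ n, ∀ M ∈ J (z n), φ M ≤ e n := by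
  have : ProperSpace (E →L[ℝ] G) := FiniteDimensional.proper_real _
  have hbdd : ∀ n, BddAbove (φ '' J (z n)) := fun n => by
    obtain ⟨U, hU, C, hC⟩ := hJ.locallyBounded (z n)
    refine ((isCompact_closedBall (0 : E →L[ℝ] G) C).bddAbove_image hφ.continuousOn).mono
      (image_mono fun M hM => ?_)
    simpa using hC _ (mem_of_mem_nhds hU) M hM
  have hne : ∀ n, (φ '' J (z n)).Nonempty := fun n => (hJ.nonempty _).image _
  refine ⟨fun n => sSup (φ '' J (z n)), ?_, fun n M hM => le_csSup (hbdd n) ⟨M, hM, rfl⟩⟩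
  have h0 : ∀ n, 0 ≤ sSup (φ '' J (z n)) := fun n =>
    Real.sSup_nonneg (by rintro _ ⟨M, -, rfl⟩; exact hφ0 M)
  have hev : ∀ ε > 0, ∀ᶠ n in atTop, ∀ M ∈ J (z n), φ M < ε := by
    intro ε hε
    have hcl := hJ.isClosed_exists_le (Y := Unit) (φ := fun q => φ q.1)
      (hφ.comp continuous_fst) ε
    have hmem : (z₀, ()) ∈ {q : E × Unit | ∃ M ∈ J q.1, ε ≤ φ M}ᶜ := by
      rintro ⟨M, hM, hle⟩
      rw [hφJ M hM] at hle
      exact absurd hle (not_le.2 hε)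
    have := (hz.prodMk_nhds (tendsto_const_nhds (x := ()))) (hcl.isOpen_compl.mem_nhds hmem)
    filter_upwards [this] with n hn M hM
    by_contra hcon
    exact hn ⟨M, hM, not_lt.1 hcon⟩
  rw [Metric.tendsto_atTop']
  intro ε hε
  obtain ⟨N, hN⟩ := eventually_atTop.1 (hev (ε / 2) (half_pos hε))
  refine ⟨N, fun n hn => ?_⟩
  rw [Real.dist_eq, sub_zero, abs_of_nonneg (h0 n)]
  refine lt_of_le_of_lt (csSup_le (hne n) ?_) (half_lt_self hε)
  rintro _ ⟨M, hM, rfl⟩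
  exact (hN n hn.le M hM).le

end SetValued

/-! ### Perturbed geometric recursions. -/

/-- The recursion `u_{k+1} = ρ u_k + e_k` with `u_0 = C`. -/
def perturbedGeometric (ρ C : ℝ) (e : ℕ → ℝ) : ℕ → ℝ
  | 0 => C
  | k + 1 => ρ * perturbedGeometric ρ C e k + e k

theorem tendsto_perturbedGeometric {ρ : ℝ} (hρ0 : 0 ≤ ρ) (hρ1 : ρ < 1) (C : ℝ) {e : ℕ → ℝ}
    (he : Tendsto e atTop (𝓝 0)) : Tendsto (perturbedGeometric ρ C e) atTop (𝓝 0) := by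
  rw [Metric.tendsto_atTop]
  intro ε hε
  -- With perturbations below this size, `ε / 2` is an upper barrier: `ρ * (ε / 2) + (1 - ρ) * (ε /
  -- 2) = ε / 2`.
  have hδ : 0 < (1 - ρ) * (ε / 2) := mul_pos (sub_pos.2 hρ1) (half_pos hε)
  obtain ⟨N, hN⟩ := Metric.tendsto_atTop.1 he _ hδ
  set u := perturbedGeometric ρ C e with hu
  have hind : ∀ j, |u (N + j)| ≤ ε / 2 + ρ ^ j * |u N| := by
    intro j
    induction j with
    | zero => simp; positivity
    | succ j ih =>
      have h1 := hN (N + j) (Nat.le_add_right _ _)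
      rw [Real.dist_eq, sub_zero] at h1
      have h2 : u (N + (j + 1)) = ρ * u (N + j) + e (N + j) := rfl
      calc |u (N + (j + 1))| ≤ ρ * |u (N + j)| + |e (N + j)| := by
            rw [h2]
            refine (abs_add_le _ _).trans_eq ?_
            rw [abs_mul, abs_of_nonneg hρ0]
        _ ≤ ρ * (ε / 2 + ρ ^ j * |u N|) + (1 - ρ) * (ε / 2) := by gcongr
        _ = ε / 2 + ρ ^ (j + 1) * |u N| := by ring
  have hlim : Tendsto (fun j : ℕ => ρ ^ j * |u N|) atTop (𝓝 0) := by
    simpa using (tendsto_pow_atTop_nhds_zero_of_lt_one hρ0 hρ1).mul_const |u N|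
  obtain ⟨K, hK⟩ := eventually_atTop.1 (hlim.eventually_lt_const (half_pos hε))
  refine ⟨N + K, fun n hn => ?_⟩
  obtain ⟨j, rfl⟩ := Nat.exists_eq_add_of_le ((Nat.le_add_right N K).trans hn)
  rw [Real.dist_eq, sub_zero]
  have := hK j (by omega)
  linarith [hind j]

/-! ### Absolutely continuous curves and Rademacher's theorem. -/

/-- The mean value inequality for absolutely continuous curves. -/
theorem norm_sub_le_of_absolutelyContinuousOnInterval {G : Type*} [NormedAddCommGroup G]
    [InnerProductSpace ℝ G] {g : ℝ → G} (hg : AbsolutelyContinuousOnInterval g 0 1) {C : ℝ}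
    (hd : ∀ᵐ t : ℝ, t ∈ Ioo (0 : ℝ) 1 → ∃ d : G, HasDerivAt g d t ∧ ‖d‖ ≤ C) :
    ‖g 1 - g 0‖ ≤ C := by
  -- A zero increment still requires `0 ≤ C`, which follows from one point where a derivative
  -- exists.
  by_cases hn : ‖g 1 - g 0‖ = 0
  · rw [hn]
    by_contra! hC
    have h1 : volume (Ioo (0 : ℝ) 1) = 0 := by
      rw [← compl_compl (Ioo (0 : ℝ) 1), ← mem_ae_iff]
      filter_upwards [hd] with t ht hmem
      obtain ⟨d, -, hle⟩ := ht hmem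
      exact absurd ((norm_nonneg d).trans hle) (not_le.2 hC)
    simp at h1
  set v := g 1 - g 0 with hv
  -- Pairing with the increment `v` makes the curve scalar; integrating its derivative gives `‖v‖ ^
  -- 2 ≤ ‖v‖ * C`.
  have hac : AbsolutelyContinuousOnInterval (fun t => inner ℝ v (g t)) 0 1 := by
    rw [absolutelyContinuousOnInterval_iff] at hg ⊢
    intro ε hε
    have hvpos : 0 < ‖v‖ := lt_of_le_of_ne (norm_nonneg _) (Ne.symm hn)
    obtain ⟨δ, hδ, h⟩ := hg (ε / ‖v‖) (div_pos hε hvpos)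
    refine ⟨δ, hδ, fun I hI hlt => ?_⟩
    have h2 := h I hI hlt
    rw [lt_div_iff₀ hvpos, Finset.sum_mul] at h2
    refine lt_of_le_of_lt (Finset.sum_le_sum fun i _ => ?_) h2
    rw [Real.dist_eq, ← inner_sub_right, dist_eq_norm, mul_comm]
    exact abs_real_inner_le_norm _ _
  have hft := hac.integral_deriv_eq_sub
  rw [← inner_sub_right, real_inner_self_eq_norm_sq] at hft
  have hle : ∫ t in (0 : ℝ)..1, deriv (fun t => inner ℝ v (g t)) t ≤
      ∫ _t in (0 : ℝ)..1, ‖v‖ * C := by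
    refine intervalIntegral.integral_mono_ae_restrict zero_le_one hac.intervalIntegrable_deriv
      intervalIntegrable_const ?_
    rw [Measure.restrict_congr_set Ioo_ae_eq_Icc.symm]
    filter_upwards [ae_restrict_of_ae hd, ae_restrict_mem measurableSet_Ioo] with t ht hmem
    obtain ⟨d, hder, hdC⟩ := ht hmem
    have h3 : HasDerivAt (fun t => inner ℝ v (g t)) (inner ℝ v d) t := by
      simpa using (hasDerivAt_const t v).inner ℝ hder
    rw [h3.deriv]
    exact (real_inner_le_norm _ _).trans (by gcongr)
  rw [hft] at hle
  simp only [intervalIntegral.integral_const, sub_zero, one_smul, sq] at hle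
  exact le_of_mul_le_mul_left hle (lt_of_le_of_ne (norm_nonneg _) (Ne.symm hn))

theorem _root_.LocallyLipschitz.absolutelyContinuousOnInterval {X : Type*} [PseudoMetricSpace X]
    {f : ℝ → X} (hf : LocallyLipschitz f) (a b : ℝ) : AbsolutelyContinuousOnInterval f a b := by
  obtain ⟨K, hK⟩ := LocallyLipschitzOn.exists_lipschitzOnWith_of_compact isCompact_uIcc
    (hf.locallyLipschitzOn (s := uIcc a b))
  exact hK.absolutelyContinuousOnInterval

/-- **Rademacher's theorem** for locally Lipschitz maps. -/
theorem _root_.LocallyLipschitz.ae_differentiableAt {E F : Type*} [NormedAddCommGroup E]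
    [NormedSpace ℝ E] [FiniteDimensional ℝ E] [MeasurableSpace E] [BorelSpace E]
    [NormedAddCommGroup F] [NormedSpace ℝ F] [FiniteDimensional ℝ F] {μ : Measure E}
    [μ.IsAddHaarMeasure] {f : E → F} (hf : LocallyLipschitz f) :
    ∀ᵐ x ∂μ, DifferentiableAt ℝ f x := by
  refine measure_null_of_locally_null _ fun x _ => ?_
  obtain ⟨K, t, ht, hK⟩ := hf x
  refine ⟨_, inter_mem self_mem_nhdsWithin (mem_nhdsWithin_of_mem_nhds (interior_mem_nhds.2 ht)), ?_⟩
  have := hK.ae_differentiableWithinAt_of_mem (μ := μ)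
  refine measure_mono_null (fun y hy => ?_) this
  intro h
  exact hy.1 ((h (interior_subset hy.2)).differentiableAt (mem_interior_iff_mem_nhds.1 hy.2))

end Piggyback

namespace Piggyback

/-! ### The fixed point map and its derivative. -/

section FixedPoint

variable {X Θ : Type*} [NormedAddCommGroup X] [InnerProductSpace ℝ X]
  [NormedAddCommGroup Θ] [NormedSpace ℝ Θ]
  {F : X × Θ → X} {JF : X × Θ → Set (X × Θ →L[ℝ] X)} {ρ : ℝ} {xbar : Θ → X}

/-- On the segment from `y` to `x` with `θ` frozen, the velocity is `(x - y, 0)`, so only the block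
`A` acts. -/
theorem IsConservativeJacobian.norm_sub_le_of_blockA_le (hF : IsConservativeJacobian F JF)
    (hcontr : ∀ z, ∀ M ∈ JF z, ‖blockA M‖ ≤ ρ) (θ : Θ) (x y : X) :
    ‖F (x, θ) - F (y, θ)‖ ≤ ρ * ‖x - y‖ := by
  set γ : ℝ → X × Θ := fun t => (y + t • (x - y), θ) with hγ
  have hlip : LocallyLipschitz γ :=
    ContDiff.locallyLipschitz (𝕂 := ℝ) (by rw [hγ]; fun_prop)
  have hder : ∀ t, HasDerivAt γ (x - y, 0) t := fun t => by
    have h1 : HasDerivAt (fun t : ℝ => y + t • (x - y)) (x - y) t := by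
      simpa using ((hasDerivAt_id t).smul_const (x - y)).const_add y
    exact h1.prodMk (hasDerivAt_const t θ)
  have h := norm_sub_le_of_absolutelyContinuousOnInterval (C := ρ * ‖x - y‖)
    ((hF.locallyLipschitz.comp hlip).absolutelyContinuousOnInterval 0 1) ?_
  · simpa [hγ] using h
  filter_upwards [hF.chain_rule γ (hlip.absolutelyContinuousOnInterval 0 1)] with t ht hmem
  obtain ⟨V, hV⟩ := hF.nonempty (γ t)
  refine ⟨_, ht hmem V hV, ?_⟩
  rw [(hder t).deriv]
  exact (blockA V).le_of_opNorm_le (hcontr _ V hV) (x - y)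

-- Inserting `F (xbar θ, θ')` leaves a contraction term `ρ * ‖xbar θ - xbar θ'‖`, absorbed on the
-- left.
omit [InnerProductSpace ℝ X] [NormedAddCommGroup Θ] [NormedSpace ℝ Θ] in
theorem norm_fixedPoint_sub_le (hρ1 : ρ < 1)
    (hlip : ∀ θ x y, ‖F (x, θ) - F (y, θ)‖ ≤ ρ * ‖x - y‖) (hfix : ∀ θ, F (xbar θ, θ) = xbar θ)
    (θ θ' : Θ) :
    ‖xbar θ - xbar θ'‖ ≤ (1 - ρ)⁻¹ * ‖F (xbar θ, θ) - F (xbar θ, θ')‖ := by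
  rw [← div_eq_inv_mul, le_div_iff₀ (sub_pos.2 hρ1)]
  have h1 : xbar θ - xbar θ' =
      (F (xbar θ, θ) - F (xbar θ, θ')) + (F (xbar θ, θ') - F (xbar θ', θ')) := by
    rw [hfix, hfix]; abel
  have h2 := (congrArg norm h1).trans_le (norm_add_le _ _)
  linarith [hlip θ' (xbar θ) (xbar θ')]

-- Continuity comes first: a Lipschitz constant of `F` is available only near `(xbar θ₀, θ₀)`, and
-- `xbar θ` has to stay in that neighborhood.
omit [InnerProductSpace ℝ X] [NormedSpace ℝ Θ] in
theorem locallyLipschitz_fixedPoint (hF : LocallyLipschitz F) (hρ1 : ρ < 1)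
    (hlip : ∀ θ x y, ‖F (x, θ) - F (y, θ)‖ ≤ ρ * ‖x - y‖)
    (hfix : ∀ θ, F (xbar θ, θ) = xbar θ) : LocallyLipschitz xbar := by
  have hkey := norm_fixedPoint_sub_le hρ1 hlip hfix
  have hρ' : 0 ≤ (1 - ρ)⁻¹ := inv_nonneg.2 (sub_pos.2 hρ1).le
  intro θ₀
  have hcont : ContinuousAt xbar θ₀ := by
    have h0 : Tendsto (fun θ => (1 - ρ)⁻¹ * ‖F (xbar θ₀, θ₀) - F (xbar θ₀, θ)‖) (𝓝 θ₀) (𝓝 0) := by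
      have hc := hF.continuous
      have : Continuous fun θ => (1 - ρ)⁻¹ * ‖F (xbar θ₀, θ₀) - F (xbar θ₀, θ)‖ := by fun_prop
      simpa using this.tendsto θ₀
    refine tendsto_iff_norm_sub_tendsto_zero.2
      (squeeze_zero (fun _ => norm_nonneg _) (fun θ => ?_) h0)
    rw [norm_sub_rev]
    exact hkey θ₀ θ
  obtain ⟨K, t, ht, hK⟩ := hF (xbar θ₀, θ₀)
  obtain ⟨U, hU, V, hV, hUV⟩ := mem_nhds_prod_iff.1 ht
  refine ⟨(1 - ρ)⁻¹.toNNReal * K, V ∩ xbar ⁻¹' U, inter_mem hV (hcont hU),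
    LipschitzOnWith.of_dist_le_mul fun θ hθ θ' hθ' => ?_⟩
  have h1 := hK.dist_le_mul (xbar θ, θ) (hUV ⟨hθ.2, hθ.1⟩) (xbar θ, θ') (hUV ⟨hθ.2, hθ'.1⟩)
  have h2 : dist (xbar θ, θ) (xbar θ, θ') = dist θ θ' := by simp [Prod.dist_eq]
  rw [h2, dist_eq_norm] at h1
  rw [dist_eq_norm, NNReal.coe_mul, Real.coe_toNNReal _ hρ', mul_assoc]
  exact (hkey θ θ').trans (mul_le_mul_of_nonneg_left h1 hρ')

omit [InnerProductSpace ℝ X] [NormedAddCommGroup Θ] [NormedSpace ℝ Θ] in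
theorem existsUnique_fixedPoint [CompleteSpace X] (hρ0 : 0 ≤ ρ) (hρ1 : ρ < 1)
    (hlip : ∀ θ x y, ‖F (x, θ) - F (y, θ)‖ ≤ ρ * ‖x - y‖) (θ : Θ) :
    ∃ y, (∀ x, F (x, θ) = x ↔ x = y) ∧
      ∀ x₀ : Θ → X, Tendsto (iterate F x₀ θ) atTop (𝓝 y) := by
  have hc : ContractingWith ⟨ρ, hρ0⟩ fun x => F (x, θ) :=
    ⟨hρ1, LipschitzWith.of_dist_le_mul fun x y => by
      rw [dist_eq_norm, dist_eq_norm]; exact hlip θ x y⟩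
  refine ⟨hc.fixedPoint, fun x => ⟨fun h => hc.fixedPoint_unique h, ?_⟩, fun x₀ => ?_⟩
  · rintro rfl
    exact hc.fixedPoint_isFixedPt
  · have heq : iterate F x₀ θ = fun n => (fun x => F (x, θ))^[n] (x₀ θ) := by
      funext n
      induction n with
      | zero => rfl
      | succ n ih => rw [Function.iterate_succ_apply', ← ih]; rfl
    rw [heq]
    exact hc.tendsto_iterate_fixedPoint _

/-- Along a line, the derivative `D` of the fixed point map satisfies `V (D v, v) = D v` for almost
every point of the line and all matrices `V` in the conservative Jacobian. -/
theorem IsConservativeJacobian.ae_line_apply_fderiv (hF : IsConservativeJacobian F JF)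
    (hx : LocallyLipschitz xbar) (hfix : ∀ θ, F (xbar θ, θ) = xbar θ) (θ v : Θ) :
    ∀ᵐ t : ℝ, DifferentiableAt ℝ xbar (θ + t • v) → ∀ V ∈ JF (xbar (θ + t • v), θ + t • v),
      V (fderiv ℝ xbar (θ + t • v) v, v) = fderiv ℝ xbar (θ + t • v) v := by
  have unit : ∀ θ : Θ, ∀ᵐ t : ℝ, t ∈ Ioo (0 : ℝ) 1 → DifferentiableAt ℝ xbar (θ + t • v) →
      ∀ V ∈ JF (xbar (θ + t • v), θ + t • v),
        V (fderiv ℝ xbar (θ + t • v) v, v) = fderiv ℝ xbar (θ + t • v) v := by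
    intro θ
    have hline : LocallyLipschitz fun t : ℝ => θ + t • v :=
      ContDiff.locallyLipschitz (𝕂 := ℝ) (by fun_prop)
    have hγ : LocallyLipschitz fun t : ℝ => (xbar (θ + t • v), θ + t • v) :=
      (hx.comp hline).prodMk hline
    filter_upwards [hF.chain_rule _ (hγ.absolutelyContinuousOnInterval 0 1)]
      with t ht hmem hdiff V hV
    have h1 : HasDerivAt (fun t : ℝ => θ + t • v) v t := by
      simpa using ((hasDerivAt_id t).smul_const v).const_add θ
    have h2 : HasDerivAt (fun t : ℝ => xbar (θ + t • v)) (fderiv ℝ xbar (θ + t • v) v) t :=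
      hdiff.hasFDerivAt.comp_hasDerivAt t h1
    have h3 := ht hmem V hV
    rw [(h2.prodMk h1).deriv] at h3
    -- By the fixed point equation, `F` along the curve is the curve's own first component, so the
    -- two derivatives agree.
    simp only [hfix] at h3
    exact h3.unique h2
  -- The chain rule covers only `(0, 1)`; shifting the base point by integer multiples of `v` covers
  -- all non-integer times.
  have hall : ∀ᵐ t : ℝ, ∀ n : ℤ, t - n ∈ Ioo (0 : ℝ) 1 →
      DifferentiableAt ℝ xbar (θ + t • v) → ∀ V ∈ JF (xbar (θ + t • v), θ + t • v),
        V (fderiv ℝ xbar (θ + t • v) v, v) = fderiv ℝ xbar (θ + t • v) v := by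
    refine ae_all_iff.2 fun n => ?_
    have := (measurePreserving_sub_right volume (n : ℝ)).quasiMeasurePreserving.ae
      (unit (θ + (n : ℝ) • v))
    filter_upwards [this] with t ht
    have heq : θ + (n : ℝ) • v + (t - n) • v = θ + t • v := by
      rw [sub_smul]; abel
    rwa [heq] at ht
  have hint : ∀ᵐ t : ℝ, t ∉ range ((↑) : ℤ → ℝ) :=
    (countable_range _).ae_notMem volume
  filter_upwards [hall, hint] with t ht hni
  refine ht ⌊t⌋ ⟨?_, ?_⟩
  · exact lt_of_le_of_ne (Int.fract_nonneg t) fun h => hni ⟨⌊t⌋, (sub_eq_zero.1 h.symm).symm⟩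
  · exact Int.fract_lt_one t

variable [FiniteDimensional ℝ X] [FiniteDimensional ℝ Θ] [MeasurableSpace Θ] [BorelSpace Θ]

theorem IsConservativeJacobian.measurableSet_apply_fderiv (hF : IsConservativeJacobian F JF)
    (hx : Continuous xbar) (v : Θ) :
    MeasurableSet {θ : Θ | DifferentiableAt ℝ xbar θ → ∀ V ∈ JF (xbar θ, θ),
      V (fderiv ℝ xbar θ v, v) = fderiv ℝ xbar θ v} := by
  let _ : MeasurableSpace X := borel X
  have : BorelSpace X := ⟨rfl⟩
  have : CompleteSpace X := FiniteDimensional.complete ℝ X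
  have hφ : Continuous fun q : (X × Θ →L[ℝ] X) × X => ‖q.1 (q.2, v) - q.2‖ := by fun_prop
  have hmeas : Measurable fun θ => ((xbar θ, θ), fderiv ℝ xbar θ v) :=
    (hx.measurable.prodMk measurable_id).prodMk (measurable_fderiv_apply_const ℝ xbar v)
  -- A nonzero defect is at least `1 / (n + 1)` for some `n`, and each such violation set is the
  -- preimage of a closed set.
  have heq : {θ : Θ | DifferentiableAt ℝ xbar θ → ∀ V ∈ JF (xbar θ, θ),
      V (fderiv ℝ xbar θ v, v) = fderiv ℝ xbar θ v} =
      {θ | DifferentiableAt ℝ xbar θ}ᶜ ∪ ⋂ n : ℕ, (fun θ => ((xbar θ, θ), fderiv ℝ xbar θ v)) ⁻¹'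
        {q : (X × Θ) × X | ∃ M ∈ JF q.1, 1 / ((n : ℝ) + 1) ≤ ‖M (q.2, v) - q.2‖}ᶜ := by
    ext θ
    refine (imp_iff_not_or.trans (or_congr Iff.rfl ?_))
    simp only [mem_iInter, mem_preimage, mem_compl_iff, mem_ofPred_eq, not_exists, not_and, not_le]
    refine ⟨fun h n V hV => ?_, fun h V hV => ?_⟩
    · rw [h V hV, sub_self, norm_zero]
      exact Nat.one_div_pos_of_nat
    · by_contra hne
      obtain ⟨n, hn⟩ := exists_nat_one_div_lt (norm_pos_iff.2 (sub_ne_zero.2 hne))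
      exact lt_asymm hn (h n V hV)
  rw [heq]
  refine (measurableSet_of_differentiableAt ℝ xbar).compl.union (MeasurableSet.iInter fun n => ?_)
  have hcl := hF.isClosed_exists_le hφ (1 / ((n : ℝ) + 1))
  exact hmeas hcl.measurableSet.compl

/-- Almost everywhere, the derivative `D` of the fixed point map satisfies `A D + B = D` for all
matrices `[A, B]` in the conservative Jacobian. -/
theorem IsConservativeJacobian.ae_comp_fderiv_fixedPoint (hF : IsConservativeJacobian F JF)
    (hx : LocallyLipschitz xbar) (hfix : ∀ θ, F (xbar θ, θ) = xbar θ) (μ : Measure Θ)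
    [μ.IsAddHaarMeasure] :
    ∀ᵐ θ ∂μ, DifferentiableAt ℝ xbar θ ∧ ∀ V ∈ JF (xbar θ, θ),
      (blockA V).comp (fderiv ℝ xbar θ) + blockB V = fderiv ℝ xbar θ := by
  let b := Module.finBasis ℝ Θ
  have hv : ∀ v : Θ, ∀ᵐ θ ∂μ, DifferentiableAt ℝ xbar θ → ∀ V ∈ JF (xbar θ, θ),
      V (fderiv ℝ xbar θ v, v) = fderiv ℝ xbar θ v := fun v =>
    ae_mem_of_ae_add_linearMap_mem (LinearMap.toSpanSingleton ℝ Θ v) volume μ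
      (hF.measurableSet_apply_fderiv hx.continuous v)
      fun θ => hF.ae_line_apply_fderiv hx hfix θ v
  -- The exceptional null set depends on the direction, so only finitely many directions are used.
  filter_upwards [hx.ae_differentiableAt (μ := μ), ae_all_iff.2 fun i => hv (b i)] with θ hd hθ
  refine ⟨hd, fun V hV => ?_⟩
  refine ContinuousLinearMap.coe_injective (b.ext fun i => ?_)
  refine Eq.trans ?_ (hθ i hd V hV)
  simp [blockA, blockB, ← map_add]

end FixedPoint

end Piggyback

namespace Piggyback

/-! ### Error estimates for the two modes. -/

section Algorithm

variable {p m : ℕ}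
  {F : EuclideanSpace ℝ (Fin p) × EuclideanSpace ℝ (Fin m) → EuclideanSpace ℝ (Fin p)}
  {JF : EuclideanSpace ℝ (Fin p) × EuclideanSpace ℝ (Fin m) →
    Set (EuclideanSpace ℝ (Fin p) × EuclideanSpace ℝ (Fin m) →L[ℝ] EuclideanSpace ℝ (Fin p))}
  {x₀ : EuclideanSpace ℝ (Fin m) → EuclideanSpace ℝ (Fin p)}
  {Jx₀ : EuclideanSpace ℝ (Fin m) →
    Set (EuclideanSpace ℝ (Fin m) →L[ℝ] EuclideanSpace ℝ (Fin p))}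
  {θ : EuclideanSpace ℝ (Fin m)} {ρ C : ℝ} {e : ℕ → ℝ}
  {D : EuclideanSpace ℝ (Fin m) →L[ℝ] EuclideanSpace ℝ (Fin p)}

/-- One step multiplies the error `v - D θdot` by `A` and adds the defect `(A D + B - D) θdot`. -/
theorem ForwardMode.norm_sub_le (hρ0 : 0 ≤ ρ) (hcontr : ∀ z, ∀ M ∈ JF z, ‖blockA M‖ ≤ ρ)
    (hC : ∀ J ∈ Jx₀ θ, ‖J - D‖ ≤ C)
    (he : ∀ n, ∀ M ∈ JF (iterate F x₀ θ n, θ), ‖(blockA M).comp D + blockB M - D‖ ≤ e n)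
    {θdot : EuclideanSpace ℝ (Fin m)} {k : ℕ} {v : EuclideanSpace ℝ (Fin p)}
    (h : ForwardMode F JF x₀ Jx₀ θ θdot k v) :
    ‖v - D θdot‖ ≤ perturbedGeometric ρ C e k * ‖θdot‖ := by
  induction h with
  | init J hJ => exact (J - D).le_of_opNorm_le (hC J hJ) θdot
  | step i xdot _ M hM ih =>
    have h1 : blockA M xdot + blockB M θdot - D θdot =
        blockA M (xdot - D θdot) + ((blockA M).comp D + blockB M - D) θdot := by
      simp [map_sub]
      abel
    have h2 := (blockA M).le_of_opNorm_le (hcontr _ M hM) (xdot - D θdot)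
    have h3 := ((blockA M).comp D + blockB M - D).le_of_opNorm_le (he i M hM) θdot
    have h4 := mul_le_mul_of_nonneg_left ih hρ0
    calc ‖blockA M xdot + blockB M θdot - D θdot‖
        ≤ ρ * ‖xdot - D θdot‖ + e i * ‖θdot‖ := by
          rw [h1]; exact (norm_add_le _ _).trans (add_le_add h2 h3)
      _ ≤ ρ * (perturbedGeometric ρ C e i * ‖θdot‖) + e i * ‖θdot‖ := by gcongr
      _ = perturbedGeometric ρ C e (i + 1) * ‖θdot‖ := by rw [perturbedGeometric]; ring

/-- The left side is a potential that does not increase as the loop descends: a step adds at most `e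
i * ‖w‖` to the error, while the second term falls from `(ρ * u i + e i) * ‖w‖` to at most `u i * (ρ
* ‖w‖)`. It starts at the right side, since `a = 0` and `w = wk`. -/
theorem ReverseLoop.norm_error_add_le (hu : ∀ i, 0 ≤ perturbedGeometric ρ C e i)
    (hcontr : ∀ z, ∀ M ∈ JF z, ‖blockA M‖ ≤ ρ)
    (he : ∀ n, ∀ M ∈ JF (iterate F x₀ θ n, θ), ‖(blockA M).comp D + blockB M - D‖ ≤ e n)
    {k i : ℕ} {wk w : EuclideanSpace ℝ (Fin p)} {a : EuclideanSpace ℝ (Fin m)}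
    (h : ReverseLoop F JF x₀ θ k wk i w a) :
    ‖a + D.adjoint w - D.adjoint wk‖ + perturbedGeometric ρ C e i * ‖w‖ ≤
      perturbedGeometric ρ C e k * ‖wk‖ := by
  induction h with
  | start => simp
  | step i w a _ M hM ih =>
    have h1 : a + (blockB M).adjoint w + D.adjoint ((blockA M).adjoint w) - D.adjoint wk =
        (a + D.adjoint w - D.adjoint wk) + ((blockA M).comp D + blockB M - D).adjoint w := by
      simp only [map_sub, map_add, ContinuousLinearMap.adjoint_comp, _root_.sub_apply,
        _root_.add_apply, ContinuousLinearMap.comp_apply]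
      abel
    have h2 : ‖(blockA M).adjoint w‖ ≤ ρ * ‖w‖ :=
      (blockA M).adjoint.le_of_opNorm_le
        ((LinearIsometryEquiv.norm_map _ _).trans_le (hcontr _ M hM)) w
    have h3 : ‖((blockA M).comp D + blockB M - D).adjoint w‖ ≤ e i * ‖w‖ :=
      ContinuousLinearMap.le_of_opNorm_le _
        ((LinearIsometryEquiv.norm_map _ _).trans_le (he i M hM)) w
    have h4 := (congrArg norm h1).trans_le (norm_add_le _ _)
    have h5 := mul_le_mul_of_nonneg_left h2 (hu i)
    rw [perturbedGeometric] at ih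
    linarith

theorem ReverseMode.norm_sub_le (hu : ∀ i, 0 ≤ perturbedGeometric ρ C e i)
    (hcontr : ∀ z, ∀ M ∈ JF z, ‖blockA M‖ ≤ ρ) (hC : ∀ J ∈ Jx₀ θ, ‖J - D‖ ≤ C)
    (he : ∀ n, ∀ M ∈ JF (iterate F x₀ θ n, θ), ‖(blockA M).comp D + blockB M - D‖ ≤ e n)
    {k : ℕ} {wk : EuclideanSpace ℝ (Fin p)} {b : EuclideanSpace ℝ (Fin m)}
    (h : ReverseMode F JF x₀ Jx₀ θ k wk b) :
    ‖b - D.adjoint wk‖ ≤ perturbedGeometric ρ C e k * ‖wk‖ := by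
  obtain ⟨w₀, a, hloop, J, hJ, rfl⟩ := h
  have h1 := hloop.norm_error_add_le hu hcontr he
  have h2 : ‖(J - D).adjoint w₀‖ ≤ C * ‖w₀‖ :=
    ContinuousLinearMap.le_of_opNorm_le _
      ((LinearIsometryEquiv.norm_map _ _).trans_le (hC J hJ)) w₀
  have h3 : a + J.adjoint w₀ - D.adjoint wk =
      (a + D.adjoint w₀ - D.adjoint wk) + (J - D).adjoint w₀ := by
    simp only [map_sub, _root_.sub_apply]
    abel
  -- At index `0` the remaining potential is `C * ‖w₀‖`, exactly what replacing `D` by `J` costs.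
  rw [perturbedGeometric] at h1
  have h4 := (congrArg norm h3).trans_le (norm_add_le _ _)
  linarith

end Algorithm

theorem perturbedGeometric_nonneg {ρ C : ℝ} {e : ℕ → ℝ} (hρ0 : 0 ≤ ρ) (hC : 0 ≤ C)
    (he : ∀ n, 0 ≤ e n) (k : ℕ) : 0 ≤ perturbedGeometric ρ C e k := by
  induction k with
  | zero => exact hC
  | succ k ih => exact add_nonneg (mul_nonneg hρ0 ih) (he k)

end Piggyback

theorem mainTheorem6 (p m : ℕ)
    (F : EuclideanSpace ℝ (Fin p) × EuclideanSpace ℝ (Fin m) → EuclideanSpace ℝ (Fin p))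
    (JF : EuclideanSpace ℝ (Fin p) × EuclideanSpace ℝ (Fin m) →
      Set (EuclideanSpace ℝ (Fin p) × EuclideanSpace ℝ (Fin m) →L[ℝ] EuclideanSpace ℝ (Fin p)))
    (hF : Piggyback.IsConservativeJacobian F JF)
    (ρ : ℝ) (hρ0 : 0 ≤ ρ) (hρ1 : ρ < 1)
    (hcontr : ∀ z, ∀ M ∈ JF z, ‖Piggyback.blockA M‖ ≤ ρ)
    (x₀ : EuclideanSpace ℝ (Fin m) → EuclideanSpace ℝ (Fin p))
    (Jx₀ : EuclideanSpace ℝ (Fin m) →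
      Set (EuclideanSpace ℝ (Fin m) →L[ℝ] EuclideanSpace ℝ (Fin p)))
    (hx₀ : Piggyback.IsConservativeJacobian x₀ Jx₀) :
    ∃ xbar : EuclideanSpace ℝ (Fin m) → EuclideanSpace ℝ (Fin p),
      (∀ θ x, F (x, θ) = x ↔ x = xbar θ) ∧
      ∀ᵐ θ : EuclideanSpace ℝ (Fin m),
        DifferentiableAt ℝ xbar θ ∧
        (∀ (θdot : EuclideanSpace ℝ (Fin m)) (xdot : ℕ → EuclideanSpace ℝ (Fin p)),
          (∀ k, Piggyback.ForwardMode F JF x₀ Jx₀ θ θdot k (xdot k)) →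
          Tendsto xdot atTop (𝓝 (fderiv ℝ xbar θ θdot))) ∧
        (∀ (w : ℕ → EuclideanSpace ℝ (Fin p)) (wbar : EuclideanSpace ℝ (Fin p))
            (θbar : ℕ → EuclideanSpace ℝ (Fin m)),
          Tendsto w atTop (𝓝 wbar) →
          (∀ k, Piggyback.ReverseMode F JF x₀ Jx₀ θ k (w k) (θbar k)) →
          Tendsto θbar atTop
            (𝓝 (ContinuousLinearMap.adjoint (fderiv ℝ xbar θ) wbar))) := by
  have hlip := fun θ x y => hF.norm_sub_le_of_blockA_le hcontr θ x y
  choose xbar hxbar hconv using Piggyback.existsUnique_fixedPoint hρ0 hρ1 hlip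
  have hfix : ∀ θ, F (xbar θ, θ) = xbar θ := fun θ => (hxbar θ _).2 rfl
  have hLL := Piggyback.locallyLipschitz_fixedPoint hF.locallyLipschitz hρ1 hlip hfix
  refine ⟨xbar, hxbar, ?_⟩
  filter_upwards [hF.ae_comp_fderiv_fixedPoint hLL hfix volume] with θ ⟨hdiff, hD⟩
  set D := fderiv ℝ xbar θ
  obtain ⟨e, he0, he⟩ := hF.exists_tendsto_zero_bound
    ((hconv θ x₀).prodMk_nhds (tendsto_const_nhds (x := θ)))
    (φ := fun M => ‖(Piggyback.blockA M).comp D + Piggyback.blockB M - D‖)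
    (by unfold Piggyback.blockA Piggyback.blockB; fun_prop) (fun M => norm_nonneg _)
    (fun M hM => by rw [hD M hM, sub_self, norm_zero])
  obtain ⟨U, hU, C₀, hC₀⟩ := hx₀.locallyBounded θ
  have hC : ∀ J ∈ Jx₀ θ, ‖J - D‖ ≤ C₀ + ‖D‖ := fun J hJ =>
    (norm_sub_le _ _).trans (add_le_add_left (hC₀ θ (mem_of_mem_nhds hU) J hJ) _)
  have hu : ∀ i, 0 ≤ Piggyback.perturbedGeometric ρ (C₀ + ‖D‖) e i := by
    refine Piggyback.perturbedGeometric_nonneg hρ0 ?_ fun n => ?_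
    · obtain ⟨J, hJ⟩ := hx₀.nonempty θ
      exact (norm_nonneg _).trans (hC J hJ)
    · obtain ⟨M, hM⟩ := hF.nonempty (Piggyback.iterate F x₀ θ n, θ)
      exact (norm_nonneg _).trans (he n M hM)
  have hlim := Piggyback.tendsto_perturbedGeometric hρ0 hρ1 (C₀ + ‖D‖) he0
  refine ⟨hdiff, fun θdot xdot hfwd => ?_, fun w wbar θbar hw hrev => ?_⟩
  · refine tendsto_iff_norm_sub_tendsto_zero.2 (squeeze_zero (fun _ => norm_nonneg _)
      (fun k => (hfwd k).norm_sub_le hρ0 hcontr hC he) ?_)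
    simpa using hlim.mul_const ‖θdot‖
  · have h1 : Tendsto (fun k => θbar k - D.adjoint (w k)) atTop (𝓝 0) := by
      refine squeeze_zero_norm (fun k => (hrev k).norm_sub_le hu hcontr hC he) ?_
      simpa using hlim.mul hw.norm
    have h2 := (D.adjoint.continuous.tendsto wbar).comp hw
    simpa using h1.add h2
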